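/- **Definitions.** Let $\Sigma$ be a finite alphabet, $\Phi$ a set of unary relations $\phi:\mathbb N\to\{0,1\}$ and $\Psi$ a set of binary relations $\psi:\mathbb N\times\mathbb N\to\{0,1\}$. A *C-RASP$[\Phi,\Psi]$ program* is a finite sequence of operations, each referring only to earlier ones. It is run on a word $w\in\Sigma^*$ with positions $1,\dots,|w|$, and each operation has a value at every position $i$. The Boolean-valued operations are - $P(i):=Q_\sigma(i)$ for $\sigma\in\Sigma$ (true iff $i\ge 1$ is a position of $w$ carrying $\sigma$), - $P(i):=\lnot P_1(i)$, $\;P(i):=P_1(i)\land P_2(i)$, $\;P(i):=\top$, - $P(i):=\phi(i)$ for $\phi\in\Phi$, - $P(i):=\bigl(C_1(i)\le C_2(i)\bigr)$; the count-valued operations (with values in $\mathbb Z$) are - $C(i):=\#\{\,1\le j\le i : \psi(i,j)=1 \text{ and } P(j)\,\}$ for $\psi\in\Psi\cup\{\top\}$, - $C(i):=C_1(i)$ if $P(i)$, and $C_2(i)$ otherwise, - $C(i):=C_1(i)+C_2(i)$, $\;C(i):=C_1(i)-C_2(i)$, $\;C(i):=1$. A program with at least one Boolean-valued operation accepts $w$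 iff its last Boolean-valued operation is true at $i=|w|$ (for the empty word the operations are evaluated by the same rules at $i=0$, where every $Q_\sigma$ is false and every counting operation is $0$). A language $L\subseteq\Sigma^*$ is in C-RASP$[\Phi,\Psi]$ if some C-RASP$[\Phi,\Psi]$ program accepts exactly the words of $L$. C-RASP$[\emptyset]$ is C-RASP$[\Phi,\Psi]$ with $\Phi=\Psi=\emptyset$. C-RASP$[\text{periodic},\text{local}]$ is C-RASP$[\Phi,\Psi]$ where $\Phi$ consists of all periodic $\phi$ (there is $\Delta>0$ with $\phi(i+\Delta)=\phi(i)$ for all $i$), and $\Psi$ consists of all $\psi$ that are translation-invariant ($\psi(i,j)=\psi(i+t,j+t)$ for all $j\le i$ and $t\ge 0$) and local (there is $\tau$ with $\psi(i,j)=0$ whenever $i>j+\tau$). A language over $\Sigma$ is *piecewise testable* if it is a finite Boolean combination of languages of the form $\Sigma^*\sigma_1\Sigma^*\sigma_2\Sigma^*\cdots\Sigma^*\sigma_n\Sigma^*$ with $n\ge 0$ and $\sigma_1,\dots,\sigma_n\in\Sigma$. **Lemma.** Let $\Sigma=\{a,b,e\}$. Then: 1. $\mathrm{PARITY}:=b^*(ab^*ab^*)^*$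 is not in C-RASP$[\text{periodic},\text{local}]$. 2. $(aa)^*$ is in C-RASP$[\text{periodic},\text{local}]$ but not in C-RASP$[\emptyset]$. 3. $\Sigma^*be^*$ is not in C-RASP$[\text{periodic},\text{local}]$. 4. Every piecewise testable language over $\Sigma$ is in C-RASP$[\emptyset]$. -/

import Mathlib

open scoped Computability

namespace CRASP

/-- Boolean-valued operations that may refer to `m` earlier Boolean-valued operations and
`n` earlier count-valued operations. -/
inductive BoolOp (α : Type*) (Φ : Set (ℕ → Bool)) (m n : ℕ) : Type _
  /-- `P(i) := Q_σ(i)` -/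
  | initial (σ : α)
  /-- `P(i) := ¬ P₁(i)` -/
  | neg (p : Fin m)
  /-- `P(i) := P₁(i) ∧ P₂(i)` -/
  | conj (p q : Fin m)
  /-- `P(i) := ⊤` -/
  | top
  /-- `P(i) := φ(i)` for `φ ∈ Φ` -/
  | positional (φ : ℕ → Bool) (hφ : φ ∈ Φ)
  /-- `P(i) := C₁(i) ≤ C₂(i)` -/
  | le (c d : Fin n)

/-- Count-valued operations that may refer to `m` earlier Boolean-valued operations and
`n` earlier count-valued operations. -/
inductive CountOp (Ψ : Set (ℕ → ℕ → Bool)) (m n : ℕ) : Type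
  /-- `C(i) := #[j ≤ i, ψ(i,j)] P(j)` for `ψ ∈ Ψ ∪ {⊤}` -/
  | count (ψ : ℕ → ℕ → Bool) (hψ : ψ ∈ Ψ ∪ {fun _ _ => true}) (p : Fin m)
  /-- `C(i) := P(i) ? C₁(i) : C₂(i)` -/
  | cond (p : Fin m) (c d : Fin n)
  /-- `C(i) := C₁(i) + C₂(i)` -/
  | add (c d : Fin n)
  /-- `C(i) := C₁(i) - C₂(i)` -/
  | sub (c d : Fin n)
  /-- `C(i) := 1` -/
  | one

/-- A `C-RASP[Φ, Ψ]` program over the alphabet `α`: a finite sequence of operations, each of which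
refers only to earlier ones. `Program α Φ Ψ m n` is the type of programs having `m` Boolean-valued
and `n` count-valued operations, in any order; each sort is numbered from `0` by order of
appearance. -/
inductive Program (α : Type*) (Φ : Set (ℕ → Bool)) (Ψ : Set (ℕ → ℕ → Bool)) : ℕ → ℕ → Type _
  | nil : Program α Φ Ψ 0 0
  | bool {m n : ℕ} (P : Program α Φ Ψ m n) (op : BoolOp α Φ m n) : Program α Φ Ψ (m + 1) n
  | count {m n : ℕ} (P : Program α Φ Ψ m n) (op : CountOp Ψ m n) : Program α Φ Ψ m (n + 1)

/-- Value at position `i` of a Boolean-valued operation on the word `w`, where `B` and `C` give the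
values of the earlier operations at position `i`. The positions of `w` are `1, …, |w|`. -/
def BoolOp.eval {α : Type*} [DecidableEq α] {Φ : Set (ℕ → Bool)} {m n : ℕ} (w : List α) (i : ℕ)
    (B : Fin m → Bool) (C : Fin n → ℤ) : BoolOp α Φ m n → Bool
  | .initial σ => decide (1 ≤ i ∧ w[i - 1]? = some σ)
  | .neg p => !B p
  | .conj p q => B p && B q
  | .top => true
  | .positional φ _ => φ i
  | .le c d => decide (C c ≤ C d)

/-- Value at position `i` of a count-valued operation, where `B j` gives the values of the earlier
Boolean-valued operations at position `j`, and `C` gives the values of the earlier count-valued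
operations at position `i`. -/
def CountOp.eval {Ψ : Set (ℕ → ℕ → Bool)} {m n : ℕ} (i : ℕ)
    (B : ℕ → Fin m → Bool) (C : Fin n → ℤ) : CountOp Ψ m n → ℤ
  | .count ψ _ p => (((Finset.Icc 1 i).filter fun j => ψ i j = true ∧ B j p = true).card : ℤ)
  | .cond p c d => if B i p = true then C c else C d
  | .add c d => C c + C d
  | .sub c d => C c - C d
  | .one => 1

/-- The values at position `i` of all the operations of a program run on the word `w`. -/
def Program.eval {α : Type*} [DecidableEq α] {Φ : Set (ℕ → Bool)} {Ψ : Set (ℕ → ℕ → Bool)}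
    (w : List α) : {m n : ℕ} → Program α Φ Ψ m n → ℕ → (Fin m → Bool) × (Fin n → ℤ)
  | _, _, .nil, _ => (Fin.elim0, Fin.elim0)
  | _, _, .bool P op, i =>
      (Fin.snoc (α := fun _ => Bool) (P.eval w i).1 (op.eval w i (P.eval w i).1 (P.eval w i).2),
        (P.eval w i).2)
  | _, _, .count P op, i =>
      ((P.eval w i).1,
        Fin.snoc (α := fun _ => ℤ) (P.eval w i).2
          (op.eval i (fun j => (P.eval w j).1) (P.eval w i).2))

/-- A program accepts `w` if its last Boolean-valued operation is true at position `|w|`. -/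
def Program.Accepts {α : Type*} [DecidableEq α] {Φ : Set (ℕ → Bool)} {Ψ : Set (ℕ → ℕ → Bool)}
    {m n : ℕ} (P : Program α Φ Ψ (m + 1) n) (w : List α) : Prop :=
  (P.eval w w.length).1 (Fin.last m) = true

/-- The class `C-RASP[Φ, Ψ]` of languages over `α`. -/
def languages (α : Type*) [DecidableEq α] (Φ : Set (ℕ → Bool)) (Ψ : Set (ℕ → ℕ → Bool)) :
    Set (Language α) :=
  {L | ∃ (m n : ℕ) (P : Program α Φ Ψ (m + 1) n), ∀ w : List α, w ∈ L ↔ P.Accepts w}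

/-- The periodic unary relations. -/
def periodic : Set (ℕ → Bool) :=
  {φ | ∃ Δ : ℕ, 0 < Δ ∧ ∀ i, φ (i + Δ) = φ i}

/-- The translation-invariant local binary relations `ψ(i,j)`. Here `i` is the position at which
the count is evaluated and `j ≤ i` is the position being counted; pairs with `j > i` are never
used. -/
def translationInvariantLocal : Set (ℕ → ℕ → Bool) :=
  {ψ | (∀ i j t : ℕ, j ≤ i → ψ i j = ψ (i + t) (j + t)) ∧
    ∃ τ : ℕ, ∀ i j : ℕ, j + τ < i → ψ i j = false}

/-- `C-RASP[periodic, local]` -/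
def periodicLocal (α : Type*) [DecidableEq α] : Set (Language α) :=
  languages α periodic translationInvariantLocal

/-- `C-RASP[∅]` -/
def noPositions (α : Type*) [DecidableEq α] : Set (Language α) :=
  languages α ∅ ∅

/-- The language `Σ* σ₁ Σ* σ₂ Σ* ⋯ Σ* σₙ Σ*` for the word `σ₁ ⋯ σₙ`. -/
def subwordLanguage {α : Type*} : List α → Language α
  | [] => ⊤
  | σ :: u => ⊤ * {[σ]} * subwordLanguage u

/-- Piecewise testable languages: Boolean combinations of the languages
`Σ* σ₁ Σ* σ₂ Σ* ⋯ Σ* σₙ Σ*`. -/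
def PiecewiseTestable {α : Type*} (L : Language α) : Prop :=
  L ∈ BooleanSubalgebra.closure (Set.range (subwordLanguage (α := α)))

/-- The alphabet `{a, b, e}`. -/
inductive Letter : Type
  | a
  | b
  | e
  deriving DecidableEq

/-- `b* (a b* a b*)*` -/
def parity : Language Letter :=
  {[Letter.b]}∗ * ({[Letter.a]} * {[Letter.b]}∗ * {[Letter.a]} * {[Letter.b]}∗)∗

/-- `(aa)*` -/
def evenA : Language Letter :=
  ({[Letter.a]} * {[Letter.a]})∗

/-- `Σ* b e*` -/
def flipFlop : Language Letter :=
  ⊤ * {[Letter.b]} * {[Letter.e]}∗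

end CRASP

/-! The negative results share one invariant. Letters of an auxiliary alphabet `ι` are coded by
blocks of length `D`: one significant letter, then padding. `D` is a multiple of every period and
large enough to absorb the look-back of all local counts. After a suitable prefix `l`, as long as
each kind of block is added at most `N` times, every Boolean operation depends only on the current
block and the offset in it, and every count is affine in the numbers of blocks of each kind.

Comparisons are the main danger, since `C₁ ≤ C₂` cuts the space of block counts along half-spaces.
But a half-space is constant on some orthant of a box (`IsAffine.exists_orthant`), so lengthening
`l` moves into a smaller box on which finitely many half-spaces are all constant
(`exists_box_constant`). Local counts could see the end of the preceding block; hence the invariant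
also says that past a threshold `T` in each block the letter is forgotten. A local count raises `T`
by at most `τ`. `Program.exists_uniform` is the resulting induction over programs. The outcome is
that a program cannot tell which block, if any, was inserted before the last one, whereas each of
the three languages can.

For the positive results, "some position satisfies `P`" means that a count is at least 1. This finds
a subword letter by letter, and with a relation of period 2 it gives `(aa)*`. -/

namespace CRASP

/-! ### Subwords and prefixes -/

theorem mem_subwordLanguage {α : Type*} {u w : List α} : w ∈ subwordLanguage u ↔ u.Sublist w := by
  induction u generalizing w with
  | nil => exact ⟨fun _ => List.nil_sublist _, fun _ => trivial⟩
  | cons σ u ih =>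
    simp only [subwordLanguage, List.cons_sublist_iff, Language.mem_mul, ih]
    constructor
    · rintro ⟨_, ⟨x, -, y, hy, rfl⟩, z, hz, rfl⟩
      have hy : y = [σ] := hy
      subst hy
      exact ⟨x ++ [σ], z, rfl, by simp, hz⟩
    · rintro ⟨r, s, rfl, hr, hs⟩
      obtain ⟨x, y, rfl⟩ := List.append_of_mem hr
      exact ⟨x ++ [σ], ⟨x, trivial, [σ], rfl, rfl⟩, y ++ s,
        hs.trans (List.sublist_append_right _ _), by simp⟩

/-- Splitting off the last letter suits counts over `j ≤ i`: the position matched to `σ` is the one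
quantified over. -/
theorem concat_sublist_take_iff {α : Type*} {u w : List α} {σ : α} {i : ℕ} :
    (u ++ [σ]).Sublist (w.take i) ↔
      ∃ j, (1 ≤ j ∧ j ≤ i) ∧ (1 ≤ j ∧ w[j - 1]? = some σ) ∧ u.Sublist (w.take (j - 1)) := by
  constructor
  · intro h
    obtain ⟨r, s, hrs, hu, hs⟩ := List.append_sublist_iff.1 h
    obtain ⟨x, y, rfl⟩ := List.append_of_mem (List.singleton_sublist.1 hs)
    have hlen : (r ++ (x ++ σ :: y)).length ≤ i := hrs ▸ List.length_take_le _ _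
    simp only [List.length_append, List.length_cons] at hlen
    refine ⟨(r ++ x).length + 1, ⟨by omega, by simp; omega⟩, ⟨by omega, ?_⟩, ?_⟩
    · have : (w.take i)[(r ++ x).length]? = some σ := by rw [hrs]; simp
      rw [List.getElem?_take] at this
      split at this
      · simpa using this
      · simp at this
    · have : w.take (r ++ x).length = r ++ x := by
        have h2 : (w.take i).take (r ++ x).length = r ++ x := by
          rw [hrs, ← List.append_assoc, List.take_left]
        rwa [List.take_take, min_eq_left (by simp; omega)] at h2
      simp only [Nat.add_sub_cancel, this]
      exact hu.trans (List.sublist_append_left _ _)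
  · rintro ⟨j, ⟨h1, hj⟩, ⟨-, hσ⟩, hu⟩
    have : w.take j = w.take (j - 1) ++ [σ] := by
      obtain ⟨k, rfl⟩ : ∃ k, j = k + 1 := ⟨j - 1, by omega⟩
      rw [List.take_add_one]
      simp only [Nat.add_sub_cancel] at hσ ⊢
      simp [hσ]
    refine List.Sublist.trans ?_ (List.take_sublist_take_left hj)
    rw [this]
    exact hu.append_right _

/-! ### Closure properties of definable operations -/

section Definability

variable {α : Type*} [DecidableEq α] {Φ : Set (ℕ → Bool)} {Ψ : Set (ℕ → ℕ → Bool)}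

/-- Renumber the operations that a Boolean-valued operation refers to. -/
def BoolOp.map {m n m' n' : ℕ} (e : Fin m → Fin m') (c : Fin n → Fin n') :
    BoolOp α Φ m n → BoolOp α Φ m' n'
  | .initial σ => .initial σ
  | .neg p => .neg (e p)
  | .conj p q => .conj (e p) (e q)
  | .top => .top
  | .positional φ h => .positional φ h
  | .le x y => .le (c x) (c y)

/-- Renumber the operations that a count-valued operation refers to. -/
def CountOp.map {m n m' n' : ℕ} (e : Fin m → Fin m') (c : Fin n → Fin n') :
    CountOp Ψ m n → CountOp Ψ m' n'
  | .count ψ h p => .count ψ h (e p)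
  | .cond p x y => .cond (e p) (c x) (c y)
  | .add x y => .add (c x) (c y)
  | .sub x y => .sub (c x) (c y)
  | .one => .one

theorem BoolOp.eval_map {m n m' n' : ℕ} (e : Fin m → Fin m') (c : Fin n → Fin n')
    (op : BoolOp α Φ m n) (w : List α) (i : ℕ) (B : Fin m' → Bool) (C : Fin n' → ℤ) :
    (op.map e c).eval w i B C = op.eval w i (fun b => B (e b)) (fun x => C (c x)) := by
  cases op <;> rfl

theorem CountOp.eval_map {m n m' n' : ℕ} (e : Fin m → Fin m') (c : Fin n → Fin n')
    (op : CountOp Ψ m n) (i : ℕ) (B : ℕ → Fin m' → Bool) (C : Fin n' → ℤ) :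
    (op.map e c).eval i B C = op.eval i (fun j b => B j (e b)) (fun x => C (c x)) := by
  cases op <;> rfl

/-- Two programs can be run one after the other. -/
theorem Program.exists_append {m n m' n' : ℕ} (P : Program α Φ Ψ m n)
    (Q : Program α Φ Ψ m' n') :
    ∃ (M N : ℕ) (R : Program α Φ Ψ M N) (e : Fin m → Fin M) (c : Fin n → Fin N)
      (e' : Fin m' → Fin M) (c' : Fin n' → Fin N), ∀ w i,
      (∀ b, (R.eval w i).1 (e b) = (P.eval w i).1 b) ∧
      (∀ x, (R.eval w i).2 (c x) = (P.eval w i).2 x) ∧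
      (∀ b, (R.eval w i).1 (e' b) = (Q.eval w i).1 b) ∧
      (∀ x, (R.eval w i).2 (c' x) = (Q.eval w i).2 x) := by
  induction Q with
  | nil =>
    exact ⟨m, n, P, id, id, Fin.elim0, Fin.elim0, fun w i =>
      ⟨fun _ => rfl, fun _ => rfl, fun b => b.elim0, fun x => x.elim0⟩⟩
  | bool Q op ih =>
    obtain ⟨M, N, R, e, c, e', c', h⟩ := ih
    refine ⟨M + 1, N, R.bool (op.map e' c'), fun b => (e b).castSucc, c,
      Fin.snoc (α := fun _ => Fin (M + 1)) (fun b => (e' b).castSucc) (Fin.last M), c',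
      fun w i => ?_⟩
    obtain ⟨h1, h2, h3, h4⟩ := h w i
    refine ⟨fun b => ?_, h2, fun b => ?_, h4⟩
    · simp [Program.eval, h1]
    · induction b using Fin.lastCases with
      | last => simp [Program.eval, BoolOp.eval_map, h3, h4]
      | cast b => simp [Program.eval, h3]
  | count Q op ih =>
    obtain ⟨M, N, R, e, c, e', c', h⟩ := ih
    refine ⟨M, N + 1, R.count (op.map e' c'), e, fun b => (c b).castSucc, e',
      Fin.snoc (α := fun _ => Fin (N + 1)) (fun b => (c' b).castSucc) (Fin.last N),
      fun w i => ?_⟩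
    -- A count reads Boolean values at all `j ≤ i`, so agreement at `i` alone is not enough.
    have h3' := fun j b => (h w j).2.2.1 b
    obtain ⟨h1, h2, h3, h4⟩ := h w i
    refine ⟨h1, fun b => ?_, h3, fun b => ?_⟩
    · simp [Program.eval, h2]
    · induction b using Fin.lastCases with
      | last => simp [Program.eval, CountOp.eval_map, h3', h4]
      | cast b => simp [Program.eval, h4]

variable (Φ Ψ) in
/-- `f` gives the values of some Boolean-valued operation of some program. -/
def BoolDefinable (f : List α → ℕ → Bool) : Prop :=
  ∃ (m n : ℕ) (P : Program α Φ Ψ m n) (b : Fin m), ∀ w i, (P.eval w i).1 b = f w i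

variable (Φ Ψ) in
/-- `f` gives the values of some count-valued operation of some program. -/
def CountDefinable (f : List α → ℕ → ℤ) : Prop :=
  ∃ (m n : ℕ) (P : Program α Φ Ψ m n) (c : Fin n), ∀ w i, (P.eval w i).2 c = f w i

theorem BoolDefinable.initial (σ : α) :
    BoolDefinable Φ Ψ fun w i => decide (1 ≤ i ∧ w[i - 1]? = some σ) :=
  ⟨1, 0, .bool .nil (.initial σ), Fin.last 0, fun w i => by
    simp only [Program.eval, Fin.snoc_last]; rfl⟩

theorem BoolDefinable.top : BoolDefinable Φ Ψ fun (_ : List α) _ => true :=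
  ⟨1, 0, .bool .nil .top, Fin.last 0, fun w i => by
    simp only [Program.eval, Fin.snoc_last]; rfl⟩

theorem BoolDefinable.positional {φ : ℕ → Bool} (h : φ ∈ Φ) :
    BoolDefinable Φ Ψ fun (_ : List α) i => φ i :=
  ⟨1, 0, .bool .nil (.positional φ h), Fin.last 0, fun w i => by
    simp only [Program.eval, Fin.snoc_last]; rfl⟩

theorem BoolDefinable.neg {f : List α → ℕ → Bool} (hf : BoolDefinable Φ Ψ f) :
    BoolDefinable Φ Ψ fun w i => !f w i := by
  obtain ⟨m, n, P, b, h⟩ := hf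
  exact ⟨m + 1, n, P.bool (.neg b), Fin.last m, fun w i => by
    simp [Program.eval, BoolOp.eval, h]⟩

theorem BoolDefinable.and {f g : List α → ℕ → Bool} (hf : BoolDefinable Φ Ψ f)
    (hg : BoolDefinable Φ Ψ g) : BoolDefinable Φ Ψ fun w i => f w i && g w i := by
  obtain ⟨m, n, P, b, hP⟩ := hf
  obtain ⟨m', n', Q, b', hQ⟩ := hg
  obtain ⟨M, N, R, e, c, e', c', h⟩ := P.exists_append Q
  exact ⟨M + 1, N, R.bool (.conj (e b) (e' b')), Fin.last M, fun w i => by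
    simp [Program.eval, BoolOp.eval, (h w i).1, (h w i).2.2.1, hP, hQ]⟩

theorem CountDefinable.le {f g : List α → ℕ → ℤ} (hf : CountDefinable Φ Ψ f)
    (hg : CountDefinable Φ Ψ g) : BoolDefinable Φ Ψ fun w i => decide (f w i ≤ g w i) := by
  obtain ⟨m, n, P, b, hP⟩ := hf
  obtain ⟨m', n', Q, b', hQ⟩ := hg
  obtain ⟨M, N, R, e, c, e', c', h⟩ := P.exists_append Q
  exact ⟨M + 1, N, R.bool (.le (c b) (c' b')), Fin.last M, fun w i => by
    simp [Program.eval, BoolOp.eval, (h w i).2.1, (h w i).2.2.2, hP, hQ]⟩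

theorem CountDefinable.one : CountDefinable Φ Ψ fun (_ : List α) _ => 1 :=
  ⟨0, 1, .count .nil .one, Fin.last 0, fun w i => by
    simp only [Program.eval, Fin.snoc_last]; rfl⟩

theorem CountDefinable.sub {f g : List α → ℕ → ℤ} (hf : CountDefinable Φ Ψ f)
    (hg : CountDefinable Φ Ψ g) : CountDefinable Φ Ψ fun w i => f w i - g w i := by
  obtain ⟨m, n, P, b, hP⟩ := hf
  obtain ⟨m', n', Q, b', hQ⟩ := hg
  obtain ⟨M, N, R, e, c, e', c', h⟩ := P.exists_append Q
  exact ⟨M, N + 1, R.count (.sub (c b) (c' b')), Fin.last N, fun w i => by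
    simp [Program.eval, CountOp.eval, (h w i).2.1, (h w i).2.2.2, hP, hQ]⟩

theorem BoolDefinable.cond {p : List α → ℕ → Bool} {f g : List α → ℕ → ℤ}
    (hp : BoolDefinable Φ Ψ p) (hf : CountDefinable Φ Ψ f) (hg : CountDefinable Φ Ψ g) :
    CountDefinable Φ Ψ fun w i => if p w i then f w i else g w i := by
  obtain ⟨m, n, P, b, hP⟩ := hf
  obtain ⟨m', n', Q, b', hQ⟩ := hg
  obtain ⟨m'', n'', S, b'', hS⟩ := hp
  obtain ⟨M, N, R, e, c, e', c', h⟩ := P.exists_append Q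
  obtain ⟨M', N', R', k, l, k', l', h'⟩ := R.exists_append S
  exact ⟨M', N' + 1, R'.count (.cond (k' b'') (l (c b)) (l (c' b'))), Fin.last N', fun w i => by
    simp [Program.eval, CountOp.eval, (h w i).2.1, (h w i).2.2.2, (h' w i).2.1,
      (h' w i).2.2.1, hP, hQ, hS]⟩

theorem BoolDefinable.count {f : List α → ℕ → Bool} (hf : BoolDefinable Φ Ψ f) :
    CountDefinable Φ Ψ
      fun w i => (((Finset.Icc 1 i).filter fun j => f w j = true).card : ℤ) := by
  obtain ⟨m, n, P, b, h⟩ := hf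
  exact ⟨m, n + 1, P.count (.count (fun _ _ => true) (by simp) b), Fin.last n, fun w i => by
    simp [Program.eval, CountOp.eval, h]⟩

theorem BoolDefinable.mem_languages {f : List α → ℕ → Bool} (hf : BoolDefinable Φ Ψ f)
    {L : Language α} (hL : ∀ w, w ∈ L ↔ f w w.length = true) : L ∈ languages α Φ Ψ := by
  obtain ⟨m, n, P, b, h⟩ := hf
  -- Acceptance reads the last Boolean operation; conjoining `b` with itself copies it there.
  exact ⟨m, n, P.bool (.conj b b), fun w => by
    simp [Program.Accepts, Program.eval, BoolOp.eval, h, hL]⟩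

theorem exists_boolDefinable_of_mem_languages {L : Language α} (hL : L ∈ languages α Φ Ψ) :
    ∃ f, BoolDefinable Φ Ψ f ∧ ∀ w, w ∈ L ↔ f w w.length = true := by
  obtain ⟨m, n, P, h⟩ := hL
  exact ⟨fun w i => (P.eval w i).1 (Fin.last m), ⟨_, _, P, _, fun _ _ => rfl⟩, h⟩

theorem compl_mem_languages {L : Language α} (hL : L ∈ languages α Φ Ψ) :
    Lᶜ ∈ languages α Φ Ψ := by
  obtain ⟨f, hf, h⟩ := exists_boolDefinable_of_mem_languages hL
  refine hf.neg.mem_languages fun w => ?_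
  have : w ∈ Lᶜ ↔ ¬ w ∈ L := Iff.rfl
  simp [this, h]

theorem sup_mem_languages {L K : Language α} (hL : L ∈ languages α Φ Ψ)
    (hK : K ∈ languages α Φ Ψ) : L ⊔ K ∈ languages α Φ Ψ := by
  obtain ⟨f, hf, h⟩ := exists_boolDefinable_of_mem_languages hL
  obtain ⟨g, hg, h'⟩ := exists_boolDefinable_of_mem_languages hK
  refine (hf.neg.and hg.neg).neg.mem_languages fun w => ?_
  have : w ∈ L ⊔ K ↔ w ∈ L ∨ w ∈ K := Iff.rfl
  simp [this, h, h']

theorem bot_mem_languages : (⊥ : Language α) ∈ languages α Φ Ψ := by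
  refine BoolDefinable.top.neg.mem_languages fun w => ?_
  have : ¬ w ∈ (⊥ : Language α) := fun h => h
  simp [this]

theorem BoolDefinable.congr {f g : List α → ℕ → Bool} (hf : BoolDefinable Φ Ψ f)
    (h : ∀ w i, f w i = true ↔ g w i = true) : BoolDefinable Φ Ψ g := by
  have : f = g := funext₂ fun w i => Bool.eq_iff_iff.2 (h w i)
  rwa [← this]

theorem BoolDefinable.exists_le {f g : List α → ℕ → Bool} (hf : BoolDefinable Φ Ψ f)
    (h : ∀ w i, g w i = true ↔ ∃ j, (1 ≤ j ∧ j ≤ i) ∧ f w j = true) : BoolDefinable Φ Ψ g := by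
  refine (CountDefinable.one.le hf.count).congr fun w i => ?_
  rw [h, decide_eq_true_eq, Nat.one_le_cast, Nat.one_le_iff_ne_zero, ← Nat.pos_iff_ne_zero,
    Finset.card_pos]
  simp [Finset.Nonempty]

/-- A strict count is the full count minus the indicator of the current position; the zero of the
indicator is written `1 - 1`. -/
theorem BoolDefinable.exists_lt {f g : List α → ℕ → Bool} (hf : BoolDefinable Φ Ψ f)
    (h : ∀ w i, g w i = true ↔ ∃ j, (1 ≤ j ∧ j ≤ i - 1) ∧ f w j = true) :
    BoolDefinable Φ Ψ g := by
  refine (CountDefinable.one.le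
    (hf.count.sub (hf.cond .one (CountDefinable.one.sub .one)))).congr fun w i => ?_
  rw [h, decide_eq_true_eq]
  obtain _ | i := i
  · simp only [show ∀ j, ¬ (1 ≤ j ∧ j ≤ 0 - 1) by omega, false_and, exists_false, iff_false]
    split <;> simp
  · have key : ((Finset.Icc 1 (i + 1)).filter fun j => f w j = true).card
        = ((Finset.Icc 1 i).filter fun j => f w j = true).card
          + if f w (i + 1) then 1 else 0 := by
      simp only [Finset.card_filter]
      exact Finset.sum_Icc_succ_top (by omega) _
    have : (1 : ℤ) ≤ (((Finset.Icc 1 (i + 1)).filter fun j => f w j = true).card : ℤ)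
        - (if f w (i + 1) then 1 else 1 - 1) ↔
        0 < ((Finset.Icc 1 i).filter fun j => f w j = true).card := by
      rw [key]; split <;> push_cast <;> omega
    rw [this, Finset.card_pos]
    simp [Finset.Nonempty]

/-- The two properties go together because extending `u` by a letter uses the strict version for
`u`. -/
theorem boolDefinable_sublist_take (u : List α) :
    BoolDefinable Φ Ψ (fun w i => decide (u.Sublist (w.take i))) ∧
      BoolDefinable Φ Ψ (fun w i => decide (u.Sublist (w.take (i - 1)))) := by
  induction u using List.reverseRecOn with
  | nil => simpa using BoolDefinable.top
  | append_singleton u σ ih =>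
    have hp := (BoolDefinable.initial (Φ := Φ) (Ψ := Ψ) σ).and ih.2
    constructor
    · exact hp.exists_le fun w i => by
        simp only [decide_eq_true_eq, Bool.and_eq_true, concat_sublist_take_iff]
    · exact hp.exists_lt fun w i => by
        simp only [decide_eq_true_eq, Bool.and_eq_true, concat_sublist_take_iff]

theorem subwordLanguage_mem_languages (u : List α) : subwordLanguage u ∈ languages α Φ Ψ :=
  (boolDefinable_sublist_take u).1.mem_languages fun w => by
    simp [mem_subwordLanguage]

theorem PiecewiseTestable.mem_languages {L : Language α} (hL : PiecewiseTestable L) :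
    L ∈ languages α Φ Ψ := by
  induction hL using BooleanSubalgebra.closure_bot_sup_induction with
  | mem L h =>
    obtain ⟨u, rfl⟩ := h
    exact subwordLanguage_mem_languages u
  | bot => exact bot_mem_languages
  | sup _ _ _ _ h h' => exact sup_mem_languages h h'
  | compl _ _ h => exact compl_mem_languages h

end Definability

/-! ### Even powers of one letter -/

theorem mem_evenA {w : List Letter} :
    w ∈ evenA ↔ (∀ x ∈ w, x = Letter.a) ∧ Even w.length := by
  rw [evenA, Language.mem_kstar]
  constructor
  · rintro ⟨S, rfl, hS⟩
    induction S with
    | nil => simp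
    | cons x S ih =>
      obtain ⟨_, rfl, _, rfl, rfl⟩ := hS x (by simp)
      obtain ⟨h1, h2⟩ := ih fun y hy => hS y (by simp [hy])
      refine ⟨?_, ?_⟩
      · simpa using h1
      · simpa [Nat.even_add, parity_simps] using h2
  · rintro ⟨h, k, hk⟩
    have : w = List.replicate (k + k) Letter.a := List.eq_replicate_iff.2 ⟨hk, h⟩
    refine ⟨List.replicate k [Letter.a, Letter.a], ?_, fun y hy => ?_⟩
    · rw [this]
      clear * -
      induction k with
      | zero => rfl
      | succ k ih =>
        rw [List.replicate_succ, List.flatten_cons, ← ih,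
          show k + 1 + (k + 1) = k + k + 1 + 1 by ring, List.replicate_succ, List.replicate_succ]
        rfl
    · rw [List.eq_of_mem_replicate hy]
      exact ⟨_, rfl, _, rfl, rfl⟩

theorem evenA_mem_periodicLocal : evenA ∈ periodicLocal Letter := by
  have hφ : (fun i : ℕ => decide (Even i)) ∈ periodic :=
    ⟨2, by norm_num, fun i => by simp [Nat.even_add]⟩
  classical
  have hex := (BoolDefinable.initial (Φ := periodic) (Ψ := translationInvariantLocal)
    Letter.a).neg.exists_le (g := fun w i => decide (∃ j, (1 ≤ j ∧ j ≤ i) ∧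
      (!decide (1 ≤ j ∧ w[j - 1]? = some Letter.a)) = true)) fun w i => by
        rw [decide_eq_true_eq]
  refine (hex.neg.and (BoolDefinable.positional hφ)).mem_languages fun w => ?_
  rw [mem_evenA]
  simp only [Bool.and_eq_true, decide_eq_true_eq]
  refine and_congr_left fun _ => ?_
  simp only [Bool.not_eq_true', decide_eq_false_iff_not, not_exists, not_and]
  rw [List.forall_mem_iff_getElem]
  constructor
  · rintro h j ⟨h1, h2⟩ hj
    refine hj h1 ?_
    rw [List.getElem?_eq_getElem (by omega), h]
  · intro h j hj
    by_contra hne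
    exact h (j + 1) ⟨by omega, hj⟩ fun _ hs => hne (by
      simpa [List.getElem?_eq_getElem hj] using hs)

/-! ### Half-spaces and boxes -/

section Affine

variable {ι : Type*}

/-- `F v` is an affine function of the numbers of occurrences of the letters in `v`. -/
def IsAffine (F : List ι → ℤ) : Prop :=
  ∃ (c : ι → ℤ) (h : ℤ), ∀ v, F v = h + (v.map c).sum

theorem IsAffine.const (h : ℤ) : IsAffine fun _ : List ι => h :=
  ⟨fun _ => 0, h, fun v => by simp⟩

theorem IsAffine.add {F G : List ι → ℤ} (hF : IsAffine F) (hG : IsAffine G) :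
    IsAffine fun v => F v + G v := by
  obtain ⟨c, h, hF⟩ := hF
  obtain ⟨d, k, hG⟩ := hG
  exact ⟨fun x => c x + d x, h + k, fun v => by beta_reduce; rw [hF, hG, List.sum_map_add]; ring⟩

theorem IsAffine.neg {F : List ι → ℤ} (hF : IsAffine F) : IsAffine fun v => -F v := by
  obtain ⟨c, h, hF⟩ := hF
  refine ⟨fun x => -c x, -h, fun v => ?_⟩
  beta_reduce
  rw [hF]
  induction v with
  | nil => simp
  | cons x v ih => simp only [List.map_cons, List.sum_cons]; linarith

theorem IsAffine.sub {F G : List ι → ℤ} (hF : IsAffine F) (hG : IsAffine G) :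
    IsAffine fun v => F v - G v := by
  simpa [sub_eq_add_neg] using hF.add hG.neg

theorem IsAffine.append_left {F : List ι → ℤ} (hF : IsAffine F) (u : List ι) :
    IsAffine fun v => F (u ++ v) := by
  obtain ⟨c, h, hF⟩ := hF
  exact ⟨c, h + (u.map c).sum, fun v => by beta_reduce; rw [hF]; simp [add_assoc]⟩

variable [DecidableEq ι]

/-- No letter occurs more than `N` times in `v`. -/
def InBox (N : ℕ) (v : List ι) : Prop := ∀ x, v.count x ≤ N

theorem inBox_nil (N : ℕ) : InBox N ([] : List ι) := fun x => by simp

theorem InBox.append {M N : ℕ} {u v : List ι} (hu : InBox M u) (hv : InBox N v) :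
    InBox (M + N) (u ++ v) := fun x => by
  rw [List.count_append]; exact add_le_add (hu x) (hv x)

theorem inBox_singleton (x : ι) : InBox 1 [x] := fun y => by
  rw [List.count_singleton]; split <;> simp

theorem InBox.mono {M N : ℕ} {v : List ι} (hv : InBox M v) (h : M ≤ N) : InBox N v :=
  fun x => (hv x).trans h

theorem InBox.of_append_left {N : ℕ} {u v : List ι} (h : InBox N (u ++ v)) : InBox N u :=
  fun x => by
  have := h x
  rw [List.count_append] at this
  omega

variable [Fintype ι]

theorem sum_map_eq_sum_count (c : ι → ℤ) (v : List ι) :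
    (v.map c).sum = ∑ x, (v.count x : ℤ) * c x := by
  rw [Finset.sum_list_map_count]
  simp only [nsmul_eq_mul]
  refine Finset.sum_subset (Finset.subset_univ _) fun x _ hx => ?_
  rw [List.count_eq_zero_of_not_mem (by simpa using hx)]
  simp

theorem exists_count_eq (m : ι → ℕ) : ∃ u : List ι, ∀ x, u.count x = m x :=
  ⟨(∑ x, Multiset.replicate (m x) x).toList, fun x => by
    rw [← Multiset.coe_count, Multiset.coe_toList, Multiset.count_sum']
    simp [Multiset.count_replicate]⟩

/-- A half-space is constant on one of the orthants of a box. -/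
theorem IsAffine.exists_orthant {F : List ι → ℤ} (hF : IsAffine F) (M : ℕ) :
    ∃ u : List ι, InBox M u ∧ ∀ v, InBox M v → (F (u ++ v) ≤ 0 ↔ F u ≤ 0) := by
  obtain ⟨c, h, hF⟩ := hF
  have key : ∀ u v, F (u ++ v) = h + ∑ x, ((u.count x : ℤ) + v.count x) * c x := fun u v => by
    rw [hF, sum_map_eq_sum_count]; simp [List.count_append]
  have key0 : ∀ u, F u = F (u ++ []) := fun u => by simp
  -- The sign at the centre `(M, …, M)` of the box of side `2M` decides. From there, the orthant in
  -- which `F` only decreases, or only increases, keeps that sign.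
  by_cases hc : h + ∑ x, (M : ℤ) * c x ≤ 0
  · obtain ⟨u, hu⟩ := exists_count_eq fun x => if c x < 0 then M else 0
    have : ∀ v, InBox M v → F (u ++ v) ≤ 0 := fun v hv => by
      refine le_trans ?_ hc
      rw [key]
      refine add_le_add le_rfl (Finset.sum_le_sum fun x _ => ?_)
      have h1 : (v.count x : ℤ) ≤ M := by exact_mod_cast hv x
      rw [hu]
      split
      · nlinarith
      · push_cast; nlinarith
    refine ⟨u, fun x => by rw [hu]; split <;> simp, fun v hv => ?_⟩
    rw [key0 u]
    exact iff_of_true (this v hv) (this [] (inBox_nil M))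
  · obtain ⟨u, hu⟩ := exists_count_eq fun x => if c x < 0 then 0 else M
    have : ∀ v, InBox M v → ¬ F (u ++ v) ≤ 0 := fun v hv h' => by
      refine hc (le_trans ?_ h')
      rw [key]
      refine add_le_add le_rfl (Finset.sum_le_sum fun x _ => ?_)
      have h1 : (v.count x : ℤ) ≤ M := by exact_mod_cast hv x
      rw [hu]
      split
      · push_cast; nlinarith
      · nlinarith
    refine ⟨u, fun x => by rw [hu]; split <;> simp, fun v hv => ?_⟩
    rw [key0 u]
    exact iff_of_false (this v hv) (this [] (inBox_nil M))

/-- Finitely many half-spaces are constant on some box of size `N` inside any sufficiently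
large box. -/
theorem exists_box_constant {κ : Type*} (s : Finset κ) (N : ℕ) :
    ∃ M : ℕ, ∀ F : κ → List ι → ℤ, (∀ k, IsAffine (F k)) →
      ∃ u : List ι, (∀ v, InBox N v → InBox M (u ++ v)) ∧
        ∀ k ∈ s, ∀ v, InBox N v → (F k (u ++ v) ≤ 0 ↔ F k u ≤ 0) := by
  classical
  induction s using Finset.induction_on with
  | empty => exact ⟨N, fun F _ => ⟨[], fun v hv => hv, by simp⟩⟩
  | insert k s _ ih =>
    obtain ⟨M, hM⟩ := ih
    -- `M` is fixed before `F`: one half `M` holds the orthant corner `u`, the other the box for the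
    -- remaining half-spaces.
    refine ⟨M + M, fun F hF => ?_⟩
    obtain ⟨u, hu, hk⟩ := (hF k).exists_orthant M
    obtain ⟨u', hu', hs⟩ := hM (fun k v => F k (u ++ v)) fun k => (hF k).append_left u
    refine ⟨u ++ u', fun v hv => ?_, fun k' hk' v hv => ?_⟩
    · rw [List.append_assoc]
      exact hu.append (hu' v hv)
    · rw [List.append_assoc]
      rcases Finset.mem_insert.1 hk' with rfl | hk'
      · rw [hk _ (hu' v hv), hk _ (by simpa using hu' [] (inBox_nil N))]
      · exact hs k' hk' v hv

end Affine

/-! ### Dependence on prefixes only -/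

section Causality

theorem take_eq_take_of_le {α : Type*} {w w' : List α} {i j : ℕ} (h : w.take i = w'.take i) (hj : j ≤ i) :
    w.take j = w'.take j := by
  have := congrArg (List.take j) h
  rwa [List.take_take, List.take_take, min_eq_left hj] at this

variable {α : Type*} [DecidableEq α] {Φ : Set (ℕ → Bool)} {Ψ : Set (ℕ → ℕ → Bool)}

/-- The values at position `i` depend only on the first `i` letters. -/
theorem Program.eval_congr {m n : ℕ} (P : Program α Φ Ψ m n) {w w' : List α} {i : ℕ}
    (h : w.take i = w'.take i) : P.eval w i = P.eval w' i := by
  induction P generalizing i with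
  | nil => rfl
  | bool P op ih =>
    simp only [Program.eval, ih h]
    congr 2
    cases op with
    | initial σ =>
      simp only [BoolOp.eval]
      refine decide_eq_decide.2 (and_congr_right fun hi => ?_)
      have := congrArg (fun l => l[i - 1]?) h
      simp only [List.getElem?_take, show i - 1 < i by omega, if_true] at this
      rw [this]
    | _ => rfl
  | count P op ih =>
    simp only [Program.eval, ih h]
    congr 2
    cases op with
    | count ψ hψ p =>
      simp only [CountOp.eval]
      congr 2
      refine Finset.filter_congr fun j hj => ?_
      rw [ih (take_eq_take_of_le h (Finset.mem_Icc.1 hj).2)]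
    | cond => simp only [CountOp.eval, ih h]
    | _ => rfl

end Causality

/-! ### Uniform behaviour on block words -/

section Blocks

variable {α ι : Type*}

/-- Each letter `x` of `u` is encoded by the block of length `D` that consists of `f x` and
padding letters `p`. -/
def blockWord (f : ι → α) (p : α) (D : ℕ) (u : List ι) : List α :=
  u.flatMap fun x => f x :: List.replicate (D - 1) p

variable {f : ι → α} {p : α} {D : ℕ}

theorem blockWord_append (u v : List ι) :
    blockWord f p D (u ++ v) = blockWord f p D u ++ blockWord f p D v := by
  simp [blockWord]

theorem blockWord_singleton (x : ι) :
    blockWord f p D [x] = f x :: List.replicate (D - 1) p := by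
  simp [blockWord]

theorem length_blockWord (hD : 0 < D) (u : List ι) :
    (blockWord f p D u).length = u.length * D := by
  induction u with
  | nil => simp [blockWord]
  | cons x u ih =>
    rw [← List.singleton_append, blockWord_append, List.length_append, ih, blockWord_singleton]
    simp only [List.length_cons, List.length_replicate, List.length_append, List.length_nil]
    rw [Nat.sub_add_cancel hD]; ring

theorem blockWord_prefix {u v : List ι} (h : u <+: v) :
    blockWord f p D u <+: blockWord f p D v := by
  obtain ⟨t, rfl⟩ := h
  rw [blockWord_append]
  exact List.prefix_append _ _

variable [DecidableEq ι]

variable (f p D) in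
/-- On the words that start with the encoding of `l ++ v ++ [σ]`, with `v` in the box of size `N`,
the value of `F` at offset `r` of the block of `σ` is `g v σ r`. -/
def Blockwise {β : Type*} (F : List α → ℕ → β) (l : List ι) (N : ℕ)
    (g : List ι → ι → ℕ → β) : Prop :=
  ∀ v, InBox N v → ∀ σ r, r < D → ∀ w, blockWord f p D (l ++ v ++ [σ]) <+: w →
    F w ((l ++ v).length * D + r + 1) = g v σ r

variable (f p D) in
/-- The value of `F` depends only on the current block, and after the first `T` positions of the
block only on the offset. -/
def BoolUniform (F : List α → ℕ → Bool) (l : List ι) (N T : ℕ) : Prop :=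
  ∃ g : ι → ℕ → Bool, Blockwise f p D F l N (fun _ => g) ∧
    ∀ r, T ≤ r → ∀ σ σ', g σ r = g σ' r

variable (f p D) in
/-- For each choice of current block and offset, the value of `F` is affine in the previous blocks.
After the first `T` positions of the block, it is affine in the blocks including the current one,
with coefficients depending only on the offset. -/
def CountUniform (F : List α → ℕ → ℤ) (l : List ι) (N T : ℕ) : Prop :=
  ∃ G : ι → ℕ → List ι → ℤ, Blockwise f p D F l N (fun v σ r => G σ r v) ∧
    (∀ σ r, IsAffine (G σ r)) ∧
    ∀ r, T ≤ r → ∃ H : List ι → ℤ, IsAffine H ∧ ∀ σ v, G σ r v = H (v ++ [σ])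

theorem Blockwise.shift {β : Type*} {F : List α → ℕ → β} {l u : List ι} {M N : ℕ}
    {g : List ι → ι → ℕ → β} (h : Blockwise f p D F l M g)
    (hu : ∀ v, InBox N v → InBox M (u ++ v)) :
    Blockwise f p D F (l ++ u) N (fun v => g (u ++ v)) := by
  intro v hv σ r hr w hw
  rw [List.append_assoc l u v] at hw ⊢
  exact h _ (hu v hv) σ r hr w hw

theorem BoolUniform.shift {F : List α → ℕ → Bool} {l u : List ι} {M N T T' : ℕ}
    (h : BoolUniform f p D F l M T) (hu : ∀ v, InBox N v → InBox M (u ++ v)) (hT : T ≤ T') :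
    BoolUniform f p D F (l ++ u) N T' := by
  obtain ⟨g, hg, hg'⟩ := h
  exact ⟨g, hg.shift hu, fun r hr => hg' r (hT.trans hr)⟩

theorem CountUniform.shift {F : List α → ℕ → ℤ} {l u : List ι} {M N T T' : ℕ}
    (h : CountUniform f p D F l M T) (hu : ∀ v, InBox N v → InBox M (u ++ v)) (hT : T ≤ T') :
    CountUniform f p D F (l ++ u) N T' := by
  obtain ⟨G, hG, hA, hG'⟩ := h
  refine ⟨fun σ r v => G σ r (u ++ v), hG.shift hu, fun σ r => (hA σ r).append_left u,
    fun r hr => ?_⟩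
  obtain ⟨H, hH, h⟩ := hG' r (hT.trans hr)
  exact ⟨fun v => H (u ++ v), hH.append_left u, fun σ v => by
    beta_reduce; rw [h, List.append_assoc]⟩

theorem BoolUniform.const (b : Bool) (l : List ι) (N T : ℕ) :
    BoolUniform f p D (fun _ _ => b) l N T :=
  ⟨fun _ _ => b, fun _ _ _ _ _ _ _ => rfl, fun _ _ _ _ => rfl⟩

theorem BoolUniform.neg {F : List α → ℕ → Bool} {l : List ι} {N T : ℕ}
    (h : BoolUniform f p D F l N T) : BoolUniform f p D (fun w i => !F w i) l N T := by
  obtain ⟨g, hg, hg'⟩ := h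
  exact ⟨fun σ r => !g σ r, fun v hv σ r hr w hw => by beta_reduce; rw [hg v hv σ r hr w hw],
    fun r hr σ σ' => by beta_reduce; rw [hg' r hr σ σ']⟩

theorem BoolUniform.and {F F' : List α → ℕ → Bool} {l : List ι} {N T : ℕ}
    (h : BoolUniform f p D F l N T) (h' : BoolUniform f p D F' l N T) :
    BoolUniform f p D (fun w i => F w i && F' w i) l N T := by
  obtain ⟨g, hg, hT⟩ := h
  obtain ⟨g', hg', hT'⟩ := h'
  exact ⟨fun σ r => g σ r && g' σ r, fun v hv σ r hr w hw => by
    beta_reduce; rw [hg v hv σ r hr w hw, hg' v hv σ r hr w hw],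
    fun r hr σ σ' => by beta_reduce; rw [hT r hr σ σ', hT' r hr σ σ']⟩

theorem BoolUniform.initial [DecidableEq α] (hD : 0 < D) (a : α) (l : List ι) (N : ℕ) {T : ℕ}
    (hT : 1 ≤ T) :
    BoolUniform f p D (fun w i => decide (1 ≤ i ∧ w[i - 1]? = some a)) l N T := by
  -- Only offset 0 shows the letter, hence the requirement `1 ≤ T`.
  refine ⟨fun σ r => decide ((if r = 0 then f σ else p) = a), ?_, ?_⟩
  · rintro v - σ r hr w ⟨t, rfl⟩
    refine decide_eq_decide.2 ?_
    rw [blockWord_append, blockWord_singleton, List.append_assoc, Nat.add_sub_cancel,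
      ← length_blockWord (f := f) (p := p) hD, List.getElem?_append_right (by simp)]
    obtain _ | r := r
    · simp
    · simp [List.getElem?_append, show r < D - 1 by omega]
  · intro r hr σ σ'
    simp [show r ≠ 0 by omega]

theorem BoolUniform.positional {φ : ℕ → Bool} (hφ : ∀ i, φ (i + D) = φ i) (l : List ι)
    (N T : ℕ) : BoolUniform f p D (fun _ i => φ i) l N T := by
  refine ⟨fun _ r => φ (r + 1), fun v _ σ r _ w _ => ?_, fun _ _ _ _ => rfl⟩
  have : ∀ k, φ (k * D + (r + 1)) = φ (r + 1) := fun k => by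
    induction k with
    | zero => simp
    | succ k ih => rw [← ih, ← hφ (k * D + (r + 1))]; congr 1; ring
  beta_reduce; rw [add_assoc, this]

theorem CountUniform.const (c : ℤ) (l : List ι) (N T : ℕ) :
    CountUniform f p D (fun _ _ => c) l N T :=
  ⟨fun _ _ _ => c, fun _ _ _ _ _ _ _ => rfl, fun _ _ => .const c,
    fun _ _ => ⟨fun _ => c, .const c, fun _ _ => rfl⟩⟩

theorem CountUniform.add {F F' : List α → ℕ → ℤ} {l : List ι} {N T : ℕ}
    (h : CountUniform f p D F l N T) (h' : CountUniform f p D F' l N T) :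
    CountUniform f p D (fun w i => F w i + F' w i) l N T := by
  obtain ⟨G, hG, hA, hT⟩ := h
  obtain ⟨G', hG', hA', hT'⟩ := h'
  refine ⟨fun σ r v => G σ r v + G' σ r v, fun v hv σ r hr w hw => by
    beta_reduce; rw [hG v hv σ r hr w hw, hG' v hv σ r hr w hw], fun σ r => (hA σ r).add (hA' σ r),
    fun r hr => ?_⟩
  obtain ⟨H, hH, e⟩ := hT r hr
  obtain ⟨H', hH', e'⟩ := hT' r hr
  exact ⟨_, hH.add hH', fun σ v => by beta_reduce; rw [e, e']⟩

theorem CountUniform.sub {F F' : List α → ℕ → ℤ} {l : List ι} {N T : ℕ}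
    (h : CountUniform f p D F l N T) (h' : CountUniform f p D F' l N T) :
    CountUniform f p D (fun w i => F w i - F' w i) l N T := by
  obtain ⟨G, hG, hA, hT⟩ := h
  obtain ⟨G', hG', hA', hT'⟩ := h'
  refine ⟨fun σ r v => G σ r v - G' σ r v, fun v hv σ r hr w hw => by
    beta_reduce; rw [hG v hv σ r hr w hw, hG' v hv σ r hr w hw], fun σ r => (hA σ r).sub (hA' σ r),
    fun r hr => ?_⟩
  obtain ⟨H, hH, e⟩ := hT r hr
  obtain ⟨H', hH', e'⟩ := hT' r hr
  exact ⟨_, hH.sub hH', fun σ v => by beta_reduce; rw [e, e']⟩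

theorem BoolUniform.cond [Nonempty ι] {P : List α → ℕ → Bool} {F F' : List α → ℕ → ℤ}
    {l : List ι} {N T : ℕ} (hP : BoolUniform f p D P l N T) (h : CountUniform f p D F l N T)
    (h' : CountUniform f p D F' l N T) :
    CountUniform f p D (fun w i => if P w i = true then F w i else F' w i) l N T := by
  obtain ⟨g, hg, hgT⟩ := hP
  obtain ⟨G, hG, hA, hT⟩ := h
  obtain ⟨G', hG', hA', hT'⟩ := h'
  obtain ⟨x⟩ := ‹Nonempty ι›
  refine ⟨fun σ r v => if g σ r = true then G σ r v else G' σ r v, fun v hv σ r hr w hw => by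
    beta_reduce; rw [hg v hv σ r hr w hw, hG v hv σ r hr w hw, hG' v hv σ r hr w hw], fun σ r => ?_,
    fun r hr => ?_⟩
  · by_cases hb : g σ r = true
    · simpa [hb] using hA σ r
    · simpa [hb] using hA' σ r
  · obtain ⟨H, hH, e⟩ := hT r hr
    obtain ⟨H', hH', e'⟩ := hT' r hr
    refine ⟨fun v => if g x r = true then H v else H' v, ?_, fun σ v => by
      beta_reduce; rw [hgT r hr σ x, e, e']⟩
    by_cases hb : g x r = true
    · simpa [hb] using hH
    · simpa [hb] using hH'

/-- The difference of two uniform counts has a constant sign on some smaller box. -/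
theorem CountUniform.exists_le [Fintype ι] (N : ℕ) :
    ∃ M : ℕ, ∀ (F : List α → ℕ → ℤ) (F' : List α → ℕ → ℤ) (l : List ι) (T : ℕ),
      CountUniform f p D F l M T → CountUniform f p D F' l M T →
      ∃ u : List ι, (∀ v, InBox N v → InBox M (u ++ v)) ∧
        BoolUniform f p D (fun w i => decide (F w i ≤ F' w i)) (l ++ u) N T := by
  -- For each offset there is one half-space per current letter, plus one (`none`) for the common
  -- form valid after `T`. The size `N + 1` ensures that one-letter words lie in the box even if `N
  -- = 0`.
  obtain ⟨M, hM⟩ := exists_box_constant (ι := ι)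
    ((Finset.univ : Finset (Option ι)) ×ˢ Finset.range D) (N + 1)
  refine ⟨M, fun F F' l T h h' => ?_⟩
  obtain ⟨G, hG, hA, hT⟩ := h.sub h'
  choose! H hH e using hT
  obtain ⟨u, hu, hs⟩ := hM (fun k => k.1.elim (if T ≤ k.2 then H k.2 else fun _ => 0)
      (fun σ => G σ k.2)) (by
    rintro ⟨_ | σ, r⟩
    · by_cases hr : T ≤ r
      · simpa [hr] using hH r hr
      · simpa [hr] using IsAffine.const 0
    · exact hA σ r)
  have hu' : ∀ v, InBox N v → InBox M (u ++ v) := fun v hv => hu v (hv.mono (Nat.le_succ N))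
  -- Independence of the letter is demanded at all `r ≥ T`, but signs are controlled only for `r <
  -- D`; beyond that the value is set to false.
  refine ⟨u, hu', fun σ r => decide (r < D ∧ G σ r u ≤ 0), fun v hv σ r hr w hw => ?_,
    fun r hr σ σ' => ?_⟩
  · have h1 := hG.shift hu' v hv σ r hr w hw
    have h2 := hs (some σ, r) (by simp [hr]) v (hv.mono (Nat.le_succ N))
    simp only [Option.elim_some] at h2
    beta_reduce at h1
    refine decide_eq_decide.2 ?_
    rw [← sub_nonpos, h1, h2]
    simp [hr]
  · refine decide_eq_decide.2 (and_congr_right fun hD => ?_)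
    have h2 := hs (none, r) (by simp [hD])
    simp only [Option.elim_none, hr, if_true] at h2
    -- Adding `σ` or `σ'` to `u` stays in the box, so both signs equal that of the common form at
    -- `u`.
    rw [e r hr, e r hr, h2 _ ((inBox_singleton σ).mono (by omega)),
      h2 _ ((inBox_singleton σ').mono (by omega))]

theorem card_filter_Icc_one (P : ℕ → Prop) [DecidablePred P] (i : ℕ) :
    (((Finset.Icc 1 i).filter P).card : ℤ)
      = ∑ j ∈ Finset.range i, if P (j + 1) then 1 else 0 := by
  rw [Finset.card_filter, Finset.range_eq_Ico,
    Finset.sum_Ico_add' (fun j => if P j then (1 : ℤ) else 0) 0 i 1, zero_add,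
    Finset.Ico_add_one_right_eq_Icc]
  push_cast
  rfl

/-- A local count of a uniform operation is uniform. -/
theorem BoolUniform.count_local {F : List α → ℕ → Bool} {l : List ι} {N T τ : ℕ}
    {ψ : ℕ → ℕ → Bool} (h : BoolUniform f p D F l (N + 1) T) (hτ : T + τ ≤ D)
    (hψ : ∀ i j t : ℕ, j ≤ i → ψ i j = ψ (i + t) (j + t))
    (hψ' : ∀ i j : ℕ, j + τ < i → ψ i j = false) (x : ι) :
    CountUniform f p D (fun w i =>
      (((Finset.Icc 1 i).filter fun j => ψ i j = true ∧ F w j = true).card : ℤ))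
      (l ++ [x]) N (T + τ) := by
  obtain ⟨g, hg, hT⟩ := h
  -- Since `T + τ ≤ D`, the window reaches at most into the preceding block, at offsets at least
  -- `T`, where `x` may stand for the actual letter. If `r ≥ T + τ`, the same holds inside the
  -- current block.
  refine ⟨fun σ r _ =>
    (∑ s ∈ Finset.range D, if ψ (D + r + 1) (s + 1) = true ∧ g x s = true then 1 else 0) +
    ∑ s ∈ Finset.range (r + 1), if ψ (r + 1) (s + 1) = true ∧ g σ s = true then 1 else 0,
    ?_, fun _ _ => .const _, fun r hr => ⟨fun _ =>
    (∑ s ∈ Finset.range D, if ψ (D + r + 1) (s + 1) = true ∧ g x s = true then 1 else 0) +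
    ∑ s ∈ Finset.range (r + 1), if ψ (r + 1) (s + 1) = true ∧ g x s = true then 1 else 0,
    .const _, fun σ _ => ?_⟩⟩
  rotate_left
  · beta_reduce
    congr 1
    refine Finset.sum_congr rfl fun s hs => ?_
    by_cases hsr : s + 1 + τ < r + 1
    · simp [hψ' _ _ hsr]
    · rw [hT s (by omega) σ x]
  · intro v hv σ r hr w hw
    -- The extra `x` after `l` guarantees a preceding block `y` on which the hypothesis applies.
    obtain ⟨v', y, hv'⟩ : ∃ v' y, [x] ++ v = v' ++ [y] :=
      ⟨_, _, (List.dropLast_append_getLast (by simp)).symm⟩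
    have hbox : InBox (N + 1) ([x] ++ v) := by
      rw [add_comm]; exact (inBox_singleton x).append hv
    have hu : l ++ [x] ++ v = l ++ v' ++ [y] := by rw [List.append_assoc, hv', List.append_assoc]
    have hlen : (l ++ [x] ++ v).length = (l ++ v').length + 1 := by
      rw [hu, List.length_append (bs := [y])]; rfl
    have hcur : ∀ s, s < D → F w ((l ++ [x] ++ v).length * D + s + 1) = g σ s := fun s hs => by
      have := hg ([x] ++ v) hbox σ s hs w
      rw [← List.append_assoc] at this
      exact this hw
    have hprev : ∀ s, s < D → F w ((l ++ v').length * D + s + 1) = g y s := fun s hs =>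
      hg v' (by rw [hv'] at hbox; exact hbox.of_append_left) y s hs w
        ((blockWord_prefix (by rw [hu]; exact List.prefix_append _ _)).trans hw)
    rw [hlen] at hcur ⊢
    set k := (l ++ v').length
    beta_reduce
    rw [card_filter_Icc_one, show (k + 1) * D + r + 1 = k * D + (D + (r + 1)) by ring,
      Finset.sum_range_add, Finset.sum_range_add, Finset.sum_eq_zero, zero_add]
    · congr 1
      · refine Finset.sum_congr rfl fun s hs => ?_
        have hs := Finset.mem_range.1 hs
        rw [hprev s hs, show k * D + (D + (r + 1)) = (D + r + 1) + k * D by ring,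
          show k * D + s + 1 = s + 1 + k * D by ring, ← hψ _ _ _ (by omega)]
        by_cases hsr : s + 1 + τ < D + r + 1
        · simp [hψ' _ _ hsr]
        · rw [hT s (by omega) y x]
      · refine Finset.sum_congr rfl fun s hs => ?_
        have hs := Finset.mem_range.1 hs
        rw [show k * D + (D + s) + 1 = (k + 1) * D + s + 1 by ring, hcur s (by omega),
          show k * D + (D + (r + 1)) = (r + 1) + (k + 1) * D by ring,
          show (k + 1) * D + s + 1 = s + 1 + (k + 1) * D by ring, ← hψ _ _ _ (by omega)]
    · intro j hj
      have hj := Finset.mem_range.1 hj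
      rw [hψ' _ _ (by omega)]
      simp

/-- A count of a uniform operation is uniform. -/
theorem BoolUniform.count [Nonempty ι] {F : List α → ℕ → Bool} {l : List ι} {N T : ℕ}
    (hD : 0 < D) (hF : ∀ w w' i, w.take i = w'.take i → F w i = F w' i)
    (h : BoolUniform f p D F l N T) :
    CountUniform f p D (fun w i => (((Finset.Icc 1 i).filter fun j => F w j = true).card : ℤ))
      l N T := by
  obtain ⟨g, hg, hT⟩ := h
  obtain ⟨x⟩ := ‹Nonempty ι›
  let c : ι → ℤ := fun σ => ∑ s ∈ Finset.range D, if g σ s = true then 1 else 0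
  -- The invariant says nothing about positions inside `l`; by causality their contribution is a
  -- constant.
  let c₀ : ℤ := ∑ j ∈ Finset.range (l.length * D),
    if F (blockWord f p D l) (j + 1) = true then 1 else 0
  have hprev : ∀ v, InBox N v → ∀ w, blockWord f p D (l ++ v) <+: w →
      (∑ j ∈ Finset.range ((l ++ v).length * D), if F w (j + 1) = true then (1 : ℤ) else 0)
        = c₀ + (v.map c).sum := by
    intro v
    induction v using List.reverseRecOn with
    | nil =>
      rintro - w hw
      simp only [List.append_nil] at hw
      simp only [List.append_nil, List.map_nil, List.sum_nil, add_zero]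
      refine Finset.sum_congr rfl fun j hj => ?_
      have hj := Finset.mem_range.1 hj
      rw [hF w (blockWord f p D l)]
      obtain ⟨t, rfl⟩ := hw
      rw [List.take_append_of_le_length (by rw [length_blockWord hD]; omega)]
    | append_singleton v σ ih =>
      intro hv w hw
      rw [← List.append_assoc] at hw ⊢
      rw [show (l ++ v ++ [σ]).length * D = (l ++ v).length * D + D by
          rw [List.length_append (bs := [σ])]; simp; ring,
        Finset.sum_range_add,
        ih hv.of_append_left w ((blockWord_prefix (List.prefix_append _ _)).trans hw)]
      simp only [List.map_append, List.sum_append, List.map_cons, List.map_nil, List.sum_cons,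
        List.sum_nil, add_zero, ← add_assoc]
      congr 1
      refine Finset.sum_congr rfl fun s hs => ?_
      rw [hg v hv.of_append_left σ s (Finset.mem_range.1 hs) w hw]
  refine ⟨fun σ r v => c₀ + (v.map c).sum +
    ∑ s ∈ Finset.range (r + 1), if s < D ∧ g σ s = true then 1 else 0, fun v hv σ r hr w hw => ?_,
    fun σ r => IsAffine.add ⟨c, c₀, fun _ => rfl⟩ (.const _), fun r hr => ?_⟩
  · beta_reduce; rw [card_filter_Icc_one, add_assoc, Finset.sum_range_add,
      hprev v hv w ((blockWord_prefix (List.prefix_append _ _)).trans hw)]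
    congr 1
    refine Finset.sum_congr rfl fun s hs => ?_
    have hs := Finset.mem_range.1 hs
    rw [hg v hv σ s (by omega) w hw]
    simp [show s < D by omega]
  · refine ⟨fun v => c₀ + (v.map c).sum -
      ∑ s ∈ (Finset.range D).filter (r < ·), if g x s = true then 1 else 0,
      IsAffine.sub ⟨c, c₀, fun _ => rfl⟩ (.const _), fun σ v => ?_⟩
    have : c σ = (∑ s ∈ Finset.range (r + 1), if s < D ∧ g σ s = true then 1 else 0) +
        ∑ s ∈ (Finset.range D).filter (r < ·), if g x s = true then 1 else 0 := by
      simp only [c]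
      rw [← Finset.sum_filter_add_sum_filter_not (Finset.range D) (r < ·), add_comm]
      congr 1
      · simp only [ite_and]
        rw [← Finset.sum_filter (s := Finset.range (r + 1)) (fun s => s < D)]
        refine Finset.sum_congr ?_ fun _ _ => rfl
        ext s
        simp only [Finset.mem_filter, Finset.mem_range]
        omega
      · refine Finset.sum_congr rfl fun s hs => ?_
        rw [hT s (by have := (Finset.mem_filter.1 hs).2; omega) σ x]
    simp only [List.map_append, List.sum_append, List.map_cons, List.map_nil, List.sum_cons,
      List.sum_nil, add_zero]
    rw [this]; ring

end Blocks

/-! ### The induction over programs -/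

section Programs

variable {α ι : Type*} {Φ : Set (ℕ → Bool)} {Ψ : Set (ℕ → ℕ → Bool)}

/-- The unary relation used by the operation, if any, has period `D`. -/
def BoolOp.HasPeriod {m n : ℕ} (D : ℕ) : BoolOp α Φ m n → Prop
  | .positional φ _ => ∀ i, φ (i + D) = φ i
  | _ => True

/-- The binary relation used by the operation, if any, is trivial or translation-invariant and
local with bound `τ`. -/
def CountOp.LocalWithin {m n : ℕ} (τ : ℕ) : CountOp Ψ m n → Prop
  | .count ψ _ _ => ψ = (fun _ _ => true) ∨
      ((∀ i j t : ℕ, j ≤ i → ψ i j = ψ (i + t) (j + t)) ∧ ∀ i j : ℕ, j + τ < i → ψ i j = false)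
  | _ => True

/-- All unary relations used by the program have period `D`, and all binary relations are trivial
or translation-invariant and local with bound `τ`. -/
def Program.Bounded (D τ : ℕ) : {m n : ℕ} → Program α Φ Ψ m n → Prop
  | _, _, .nil => True
  | _, _, .bool P op => P.Bounded D τ ∧ op.HasPeriod D
  | _, _, .count P op => P.Bounded D τ ∧ op.LocalWithin τ

theorem BoolOp.HasPeriod.mul {m n D : ℕ} {op : BoolOp α Φ m n} (h : op.HasPeriod D) (k : ℕ) :
    op.HasPeriod (D * k) := by
  cases op with
  | positional φ hφ =>
    intro i
    have h : ∀ i, φ (i + D) = φ i := h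
    induction k with
    | zero => simp
    | succ k ih => rw [mul_add, mul_one, ← add_assoc, h, ih]
  | _ => trivial

theorem CountOp.LocalWithin.mono {m n τ τ' : ℕ} {op : CountOp Ψ m n} (h : op.LocalWithin τ)
    (hτ : τ ≤ τ') : op.LocalWithin τ' := by
  cases op with
  | count ψ hψ p => exact h.imp_right fun ⟨h1, h2⟩ => ⟨h1, fun i j hij => h2 i j (by omega)⟩
  | _ => trivial

theorem Program.Bounded.mono {m n D τ τ' : ℕ} {P : Program α Φ Ψ m n} (h : P.Bounded D τ)
    (k : ℕ) (hτ : τ ≤ τ') : P.Bounded (D * k) τ' := by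
  induction P with
  | nil => trivial
  | bool P op ih => exact ⟨ih h.1, h.2.mul k⟩
  | count P op ih => exact ⟨ih h.1, h.2.mono hτ⟩

theorem Program.exists_bounded {m n : ℕ}
    (P : Program α periodic translationInvariantLocal m n) :
    ∃ D τ, 0 < D ∧ P.Bounded D τ := by
  induction P with
  | nil => exact ⟨1, 0, one_pos, trivial⟩
  | bool P op ih =>
    obtain ⟨D, τ, hD, h⟩ := ih
    obtain ⟨Δ, hΔ, hop⟩ : ∃ Δ, 0 < Δ ∧ op.HasPeriod Δ := by
      cases op with
      | positional φ hφ => exact hφ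
      | _ => exact ⟨1, one_pos, trivial⟩
    exact ⟨D * Δ, τ, Nat.mul_pos hD hΔ, h.mono Δ le_rfl, mul_comm Δ D ▸ hop.mul D⟩
  | count P op ih =>
    obtain ⟨D, τ, hD, h⟩ := ih
    obtain ⟨τ', hop⟩ : ∃ τ', op.LocalWithin τ' := by
      cases op with
      | count ψ hψ p =>
        rcases hψ with ⟨h1, τ', h2⟩ | hψ
        · exact ⟨τ', Or.inr ⟨h1, h2⟩⟩
        · exact ⟨0, Or.inl hψ⟩
      | _ => exact ⟨0, trivial⟩
    refine ⟨D, max τ τ', hD, ?_, hop.mono (le_max_right _ _)⟩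
    simpa using h.mono 1 (le_max_left τ τ')

theorem Program.bounded_of_empty {m n : ℕ} (P : Program α ∅ ∅ m n) : P.Bounded 1 0 := by
  induction P with
  | nil => trivial
  | bool P op ih =>
    refine ⟨ih, ?_⟩
    cases op with
    | positional φ hφ => exact hφ.elim
    | _ => trivial
  | count P op ih =>
    refine ⟨ih, ?_⟩
    cases op with
    | count ψ hψ p => exact Or.inl (by simpa using hψ)
    | _ => trivial

variable [DecidableEq α] [DecidableEq ι] {f : ι → α} {p : α} {D : ℕ}

variable (f p D) in
/-- All operations of the program are uniform. -/
def Program.Uniform {m n : ℕ} (P : Program α Φ Ψ m n) (l : List ι) (N T : ℕ) : Prop :=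
  (∀ b, BoolUniform f p D (fun w i => (P.eval w i).1 b) l N T) ∧
    ∀ c, CountUniform f p D (fun w i => (P.eval w i).2 c) l N T

theorem Program.Uniform.shift {m n : ℕ} {P : Program α Φ Ψ m n} {l u : List ι} {M N T T' : ℕ}
    (h : P.Uniform f p D l M T) (hu : ∀ v, InBox N v → InBox M (u ++ v)) (hT : T ≤ T') :
    P.Uniform f p D (l ++ u) N T' :=
  ⟨fun b => (h.1 b).shift hu hT, fun c => (h.2 c).shift hu hT⟩

theorem Program.Uniform.bool {m n : ℕ} {P : Program α Φ Ψ m n} {op : BoolOp α Φ m n}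
    {l : List ι} {N T : ℕ} (h : P.Uniform f p D l N T)
    (hop : BoolUniform f p D (fun w i => op.eval w i (P.eval w i).1 (P.eval w i).2) l N T) :
    (P.bool op).Uniform f p D l N T := by
  refine ⟨fun b => ?_, h.2⟩
  induction b using Fin.lastCases with
  | last => simpa only [Program.eval, Fin.snoc_last] using hop
  | cast b => simpa only [Program.eval, Fin.snoc_castSucc] using h.1 b

theorem Program.Uniform.count {m n : ℕ} {P : Program α Φ Ψ m n} {op : CountOp Ψ m n}
    {l : List ι} {N T : ℕ} (h : P.Uniform f p D l N T)
    (hop : CountUniform f p D (fun w i => op.eval i (fun j => (P.eval w j).1) (P.eval w i).2)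
      l N T) :
    (P.count op).Uniform f p D l N T := by
  refine ⟨h.1, fun c => ?_⟩
  induction c using Fin.lastCases with
  | last => simpa only [Program.eval, Fin.snoc_last] using hop
  | cast c => simpa only [Program.eval, Fin.snoc_castSucc] using h.2 c

/-- If the blocks are long enough, then every program is uniform on arbitrarily large boxes. -/
theorem Program.exists_uniform [Fintype ι] [Nonempty ι] {m n τ : ℕ} (P : Program α Φ Ψ m n)
    (hP : P.Bounded D τ) (hD : 1 + (m + n) * τ ≤ D) (N : ℕ) :
    ∃ l, P.Uniform f p D l N (1 + (m + n) * τ) := by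
  induction P generalizing N with
  | nil => exact ⟨[], fun b => b.elim0, fun c => c.elim0⟩
  | @bool m n P op ih =>
    have hT : 1 + (m + n) * τ ≤ 1 + (m + 1 + n) * τ := by gcongr; omega
    have step : ∀ l, P.Uniform f p D l N (1 + (m + n) * τ) →
        (P.Uniform f p D l N (1 + (m + 1 + n) * τ) →
          BoolUniform f p D (fun w i => op.eval w i (P.eval w i).1 (P.eval w i).2) l N
          (1 + (m + 1 + n) * τ)) → ∃ l, (P.bool op).Uniform f p D l N (1 + (m + 1 + n) * τ) := by
      intro l h hop
      have h' : P.Uniform f p D l N (1 + (m + 1 + n) * τ) := by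
        simpa using h.shift (u := []) (fun v hv => hv) hT
      exact ⟨l, h'.bool (hop h')⟩
    have ih := ih hP.1 (hT.trans hD)
    cases op with
    | initial σ =>
      obtain ⟨l, hl⟩ := ih N
      exact step l hl fun h => .initial (by omega) σ l N (by omega)
    | neg b =>
      obtain ⟨l, hl⟩ := ih N
      exact step l hl fun h => (h.1 b).neg
    | conj b b' =>
      obtain ⟨l, hl⟩ := ih N
      exact step l hl fun h => (h.1 b).and (h.1 b')
    | top =>
      obtain ⟨l, hl⟩ := ih N
      exact step l hl fun h => .const true l N _
    | positional φ hφ =>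
      obtain ⟨l, hl⟩ := ih N
      exact step l hl fun h => .positional hP.2 l N _
    | le c d =>
      -- The order matters: `M` depends on `N` only, then `l` is chosen for `M`, then `u` for the
      -- two counts.
      obtain ⟨M, hM⟩ := CountUniform.exists_le (f := f) (p := p) (D := D) N
      obtain ⟨l, hl⟩ := ih M
      obtain ⟨u, hu, h⟩ := hM _ _ l _ (hl.2 c) (hl.2 d)
      refine step (l ++ u) (hl.shift hu le_rfl) fun _ => ?_
      have h := h.shift (u := []) (N := N) (fun v hv => hv) hT
      rw [List.append_nil] at h
      exact h
  | @count m n P op ih =>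
    have hT : 1 + (m + n) * τ + τ = 1 + (m + (n + 1)) * τ := by ring
    have hT' : 1 + (m + n) * τ ≤ 1 + (m + (n + 1)) * τ := by omega
    have ih := ih hP.1 (hT'.trans hD)
    let x : ι := Classical.arbitrary ι
    have hx : ∀ v, InBox N v → InBox (N + 1) ([x] ++ v) := fun v hv => by
      rw [add_comm]; exact (inBox_singleton x).append hv
    -- The spare unit pays for the block `x`, which local counts need in front.
    obtain ⟨l, hl⟩ := ih (N + 1)
    have h' := hl.shift hx hT'
    refine ⟨l ++ [x], h'.count ?_⟩
    cases op with
    | count ψ hψ b =>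
      rcases hP.2 with rfl | ⟨h1, h2⟩
      · simp only [CountOp.eval, true_and]
        exact (h'.1 b).count (by omega) fun w w' i h => by rw [P.eval_congr h]
      · rw [← hT] at hD ⊢
        exact (hl.1 b).count_local hD h1 h2 x
    | cond b c d =>
      exact (h'.1 b).cond (h'.2 c) (h'.2 d)
    | add c d => exact (h'.2 c).add (h'.2 d)
    | sub c d => exact (h'.2 c).sub (h'.2 d)
    | one => exact .const 1 _ _ _

/-- A program whose relations have period `D` and locality bound `τ` does not see which block
precedes the last one, after some word. -/
theorem Program.exists_accepts_iff [Fintype ι] [Nonempty ι] (f : ι → α) (p : α) {m n τ : ℕ}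
    (P : Program α Φ Ψ (m + 1) n) (hP : P.Bounded D τ) (hD : 1 + (m + 1 + n) * τ ≤ D) :
    ∃ l : List ι, ∀ u v x, u.length ≤ 1 → v.length ≤ 1 →
      (P.Accepts (blockWord f p D (l ++ u ++ [x])) ↔
        P.Accepts (blockWord f p D (l ++ v ++ [x]))) := by
  obtain ⟨l, hl⟩ := P.exists_uniform (f := f) (p := p) hP hD 1
  obtain ⟨g, hg, -⟩ := hl.1 (Fin.last m)
  have key : ∀ (u : List ι) x, u.length ≤ 1 →
      (P.Accepts (blockWord f p D (l ++ u ++ [x])) ↔ g x (D - 1) = true) := fun u x hu => by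
    -- Offset `D - 1` of the last block is the end of the word.
    have := hg u (fun y => List.count_le_length.trans hu) x (D - 1) (by omega) _
      (List.prefix_refl _)
    beta_reduce at this
    rw [Program.Accepts, ← this, length_blockWord (by omega)]
    have hlen : (l ++ u ++ [x]).length * D = (l ++ u).length * D + (D - 1) + 1 := by
      rw [List.length_append (bs := [x]), List.length_singleton, add_mul, one_mul]
      omega
    rw [hlen]
  exact ⟨l, fun u v x hu hv => (key u x hu).trans (key v x hv).symm⟩

/-- The common period is multiplied by `1 + (m + 1 + n) * τ`, so the block length is still a period
and exceeds the total look-back. -/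
theorem exists_blockWord_mem_iff_of_mem_periodicLocal [Fintype ι] [Nonempty ι] (f : ι → α) (p : α)
    {L : Language α} (hL : L ∈ periodicLocal α) :
    ∃ (D : ℕ) (l : List ι), 0 < D ∧ ∀ u v x, u.length ≤ 1 → v.length ≤ 1 →
      (blockWord f p D (l ++ u ++ [x]) ∈ L ↔ blockWord f p D (l ++ v ++ [x]) ∈ L) := by
  obtain ⟨m, n, P, h⟩ := hL
  obtain ⟨D, τ, hD, hP⟩ := P.exists_bounded
  obtain ⟨l, hl⟩ := (P.exists_accepts_iff f p (hP.mono (1 + (m + 1 + n) * τ) le_rfl)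
    (Nat.le_mul_of_pos_left _ hD))
  exact ⟨D * (1 + (m + 1 + n) * τ), l, Nat.mul_pos hD (by omega), fun u v x hu hv => by
    rw [h, h]; exact hl u v x hu hv⟩

/-- Without positional relations, period 1 and look-back 0 suffice, so blocks are single letters. -/
theorem exists_mem_iff_of_mem_noPositions [Fintype ι] [Nonempty ι] (f : ι → α)
    {L : Language α} (hL : L ∈ noPositions α) :
    ∃ l : List ι, ∀ u v x, u.length ≤ 1 → v.length ≤ 1 →
      ((l ++ u ++ [x]).map f ∈ L ↔ (l ++ v ++ [x]).map f ∈ L) := by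
  obtain ⟨m, n, P, h⟩ := hL
  let y : ι := Classical.arbitrary ι
  obtain ⟨l, hl⟩ := P.exists_accepts_iff f (f y) P.bounded_of_empty (by omega)
  have hmap : ∀ u, blockWord f (f y) 1 u = u.map f := fun u => by
    simp [blockWord, List.map_eq_flatMap]
  exact ⟨l, fun u v x hu hv => by
    rw [h, h]; simpa only [hmap] using hl u v x hu hv⟩

end Programs

/-! ### The three languages outside the classes -/

theorem evenA_notMem_noPositions : evenA ∉ noPositions Letter := fun h => by
  obtain ⟨l, hl⟩ := exists_mem_iff_of_mem_noPositions (fun _ : Unit => Letter.a) h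
  have := hl [] [()] () (by simp) (by simp)
  simp only [mem_evenA, List.length_map, List.length_append] at this
  simp only [List.mem_map, forall_exists_index, and_imp, List.length_cons, List.length_nil,
    Nat.even_add] at this
  simp at this
  rw [← Nat.not_even_iff_odd] at this
  tauto

theorem not_flipFlop_of_append (w : List Letter) (k : ℕ) :
    w ++ Letter.a :: List.replicate k Letter.e ∉ flipFlop := by
  rintro ⟨_, ⟨x, -, _, rfl, rfl⟩, z, hz, h⟩
  have hz : ∀ y ∈ z, y = Letter.e := by
    obtain ⟨S, rfl, hS⟩ := Language.mem_kstar.1 hz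
    intro y hy
    obtain ⟨s, hs, hy⟩ := List.mem_flatten.1 hy
    have : s = [Letter.e] := hS s hs
    simpa [this] using hy
  have h1 : z.filter (· ≠ Letter.e) = [] := by
    simpa [List.filter_eq_nil_iff] using hz
  -- The last letter other than `e` would be both `a` and `b`.
  have h2 := congrArg (fun l => (l.filter (· ≠ Letter.e)).getLast?) h
  simp only [List.filter_append, h1] at h2
  simp at h2

theorem flipFlop_of_append (w : List Letter) (k : ℕ) :
    w ++ Letter.b :: List.replicate k Letter.e ∈ flipFlop := by
  refine ⟨w ++ [Letter.b], ⟨w, trivial, _, rfl, rfl⟩, List.replicate k Letter.e,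
    Language.mem_kstar.2 ⟨List.replicate k [Letter.e], ?_, ?_⟩, by simp⟩
  · simp
  · intro y hy
    rw [List.eq_of_mem_replicate hy]; rfl

instance : Fintype Letter := ⟨{Letter.a, Letter.b, Letter.e}, fun x => by cases x <;> decide⟩

/-- With padding `e` and a last block of `e` only, the preceding block, `a` or `b`, decides
membership. -/
theorem flipFlop_notMem_periodicLocal : flipFlop ∉ periodicLocal Letter := fun h => by
  have : Nonempty Letter := ⟨Letter.e⟩
  obtain ⟨D, l, hD, hl⟩ := exists_blockWord_mem_iff_of_mem_periodicLocal id Letter.e h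
  have key : ∀ x, blockWord id Letter.e D (l ++ [x] ++ [Letter.e]) =
      blockWord id Letter.e D l ++ x :: List.replicate (D - 1 + D) Letter.e := fun x => by
    obtain ⟨k, rfl⟩ : ∃ k, D = k + 1 := ⟨D - 1, by omega⟩
    rw [blockWord_append, blockWord_append, blockWord_singleton, blockWord_singleton]
    simp [List.replicate_add, List.replicate_succ]
  have := hl [Letter.a] [Letter.b] Letter.e (by simp) (by simp)
  rw [key, key] at this
  exact not_flipFlop_of_append _ _ (this.2 (flipFlop_of_append _ _))

theorem append_mem_kstar {α : Type*} {K : Language α} {u v : List α} (hu : u ∈ K)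
    (hv : v ∈ K∗) : u ++ v ∈ K∗ := by
  obtain ⟨S, rfl, hS⟩ := Language.mem_kstar.1 hv
  exact Language.mem_kstar.2 ⟨u :: S, rfl, List.forall_mem_cons.2 ⟨hu, hS⟩⟩

theorem count_of_mem_kstar {K : Language Letter}
    (hK : ∀ w ∈ K, (∀ x ∈ w, x ≠ Letter.e) ∧ Even (w.count Letter.a)) {w : List Letter}
    (hw : w ∈ K∗) : (∀ x ∈ w, x ≠ Letter.e) ∧ Even (w.count Letter.a) := by
  obtain ⟨S, rfl, hS⟩ := Language.mem_kstar.1 hw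
  clear hw
  induction S with
  | nil => simp
  | cons u S ih =>
    obtain ⟨h1, h2⟩ := hK u (hS u (by simp))
    obtain ⟨h3, h4⟩ := ih fun y hy => hS y (by simp [hy])
    rw [List.flatten_cons, List.count_append]
    exact ⟨fun x hx => (List.mem_append.1 hx).elim (h1 x) (h3 x), h2.add h4⟩

theorem mem_parity {w : List Letter} :
    w ∈ parity ↔ (∀ x ∈ w, x ≠ Letter.e) ∧ Even (w.count Letter.a) := by
  set B : Language Letter := {[Letter.b]}∗ with hB
  set X : Language Letter := {[Letter.a]} * B * {[Letter.a]} * B with hX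
  have hpar : parity = B * X∗ := rfl
  rw [hpar]
  have hBcount : ∀ w ∈ B, (∀ x ∈ w, x ≠ Letter.e) ∧ Even (w.count Letter.a) := fun w hw =>
    count_of_mem_kstar (fun u hu => by
      have hu : u = [Letter.b] := hu
      subst hu; decide) hw
  have hXcount : ∀ w ∈ X, (∀ x ∈ w, x ≠ Letter.e) ∧ Even (w.count Letter.a) := by
    rintro _ ⟨_, ⟨_, ⟨_, rfl, y, hy, rfl⟩, _, rfl, rfl⟩, z, hz, rfl⟩
    obtain ⟨h1, h2⟩ := hBcount y hy
    obtain ⟨h3, h4⟩ := hBcount z hz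
    constructor
    · intro x hx
      simp only [List.mem_append, List.mem_singleton] at hx
      rcases hx with ((rfl | hx) | rfl) | hx
      · decide
      · exact h1 x hx
      · decide
      · exact h3 x hx
    · simp only [List.count_append, Nat.even_add, h2, h4]
      decide
  constructor
  · rintro ⟨u, hu, v, hv, rfl⟩
    obtain ⟨h1, h2⟩ := hBcount u hu
    obtain ⟨h3, h4⟩ := count_of_mem_kstar hXcount hv
    exact ⟨fun x hx => (List.mem_append.1 hx).elim (h1 x) (h3 x), by
      beta_reduce; rw [List.count_append]; exact h2.add h4⟩
  · rintro ⟨he, hw⟩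
    have hnil : ([] : List Letter) ∈ B := Language.nil_mem_kstar _
    -- The odd case is carried along because reading an `a` from the left swaps the two cases.
    have key : (Even (w.count Letter.a) → w ∈ B * X∗) ∧
        (¬ Even (w.count Letter.a) → w ∈ B * ({[Letter.a]} * (B * X∗))) := by
      clear hw
      induction w with
      | nil => exact ⟨fun _ => ⟨[], hnil, [], Language.nil_mem_kstar _, rfl⟩, fun h => by simp at h⟩
      | cons x w ih =>
        obtain ⟨h1, h2⟩ := ih fun y hy => he y (by simp [hy])
        have hx := he x (by simp)
        cases x with
        | a =>
          rw [List.count_cons_self, Nat.even_add_one, not_not]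
          refine ⟨fun h => ?_, fun h => ⟨[], hnil, _, ⟨_, rfl, w, h1 h, rfl⟩, rfl⟩⟩
          obtain ⟨u, hu, _, ⟨_, rfl, _, ⟨v, hv, t, ht, rfl⟩, rfl⟩, rfl⟩ := h2 h
          refine ⟨[], hnil, _, append_mem_kstar (u := [Letter.a] ++ u ++ [Letter.a] ++ v)
            ⟨_, ⟨_, ⟨_, rfl, u, hu, rfl⟩, _, rfl, rfl⟩, v, hv, rfl⟩ ht, by simp⟩
        | b =>
          rw [List.count_cons_of_ne (by decide)]
          constructor
          · intro h
            obtain ⟨u, hu, v, hv, rfl⟩ := h1 h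
            exact ⟨_, append_mem_kstar (u := [Letter.b]) rfl hu, v, hv, rfl⟩
          · intro h
            obtain ⟨u, hu, v, hv, rfl⟩ := h2 h
            exact ⟨_, append_mem_kstar (u := [Letter.b]) rfl hu, v, hv, rfl⟩
        | e => exact absurd rfl hx
    exact key.1 hw

/-- With padding `b`, inserting the block of `true` adds exactly one `a`, which flips membership. -/
theorem parity_notMem_periodicLocal : parity ∉ periodicLocal Letter := fun h => by
  let f : Bool → Letter := fun x => if x then Letter.a else Letter.b
  obtain ⟨D, l, hD, hl⟩ := exists_blockWord_mem_iff_of_mem_periodicLocal f Letter.b h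
  have hf : ∀ x, f x ≠ Letter.e := by decide
  have he : ∀ u, ∀ x ∈ blockWord f Letter.b D u, x ≠ Letter.e := fun u x hx => by
    obtain ⟨y, -, hy⟩ := List.mem_flatMap.1 hx
    rcases List.mem_cons.1 hy with rfl | hy
    · exact hf y
    · rw [List.eq_of_mem_replicate hy]; decide
  have hcount : (blockWord f Letter.b D [true]).count Letter.a = 1 := by
    simp [blockWord_singleton, f, List.count_replicate]
  have := hl [] [true] false (by simp) (by simp)
  rw [mem_parity, mem_parity, and_iff_right (he _), and_iff_right (he _)] at this
  simp only [List.append_nil, blockWord_append, List.count_append, hcount, Nat.even_add,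
    Nat.not_even_one] at this
  tauto

end CRASP

theorem mainTheorem5 :
    CRASP.parity ∉ CRASP.periodicLocal CRASP.Letter ∧
    (CRASP.evenA ∈ CRASP.periodicLocal CRASP.Letter ∧
      CRASP.evenA ∉ CRASP.noPositions CRASP.Letter) ∧
    CRASP.flipFlop ∉ CRASP.periodicLocal CRASP.Letter ∧
    ∀ L : Language CRASP.Letter, CRASP.PiecewiseTestable L →
      L ∈ CRASP.noPositions CRASP.Letter :=
  ⟨CRASP.parity_notMem_periodicLocal,
    ⟨CRASP.evenA_mem_periodicLocal, CRASP.evenA_notMem_noPositions⟩,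
    CRASP.flipFlop_notMem_periodicLocal, fun _ hL => hL.mem_languages⟩
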